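/- Let $A$ be a commutative Noetherian ring and $I$ an ideal of $A$. Let $\mathbf S(I)=\bigoplus_{n\ge 0}\mathbf S_n(I)$ be the symmetric algebra of $I$, let $\mathcal R(I)=\bigoplus_{n\ge 0}I^nt^n\subseteq A[t]$ be the Rees algebra, and let $\alpha:\mathbf S(I)\to\mathcal R(I)$ be the canonical graded surjection, with components $\alpha_n:\mathbf S_n(I)\to I^n$. For $n\ge 2$ put $E(I)_n=\ker(\alpha_n)/\mathbf S_1(I)\cdot\ker(\alpha_{n-1})$. The set of sifted degrees, the sifted type and the relation type of $I$ are $$\mathrm{SD}(I)=\{1\}\cup\{n\ge 2: E(I)_n\neq 0\},\qquad \mathrm{st}(I)=\operatorname{card}\mathrm{SD}(I),$$ $$\mathrm{rt}(I)=\min\{r\ge 1: E(I)_n=0\text{ for all }n\ge r+1\}.$$ Let $(F_i)_{i\ge 0}$ be the Fibonacci sequence, $F_0=0$, $F_1=1$, $F_{i+2}=F_{i+1}+F_i$, let $\varphi=\frac{1+\sqrt5}{2}$, and let $A=\Bbbk[a_1,a_2]$ be the polynomial ring in two variables over an arbitrary field $\Bbbk$. (1) For every integer $\ell\ge 4$,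 the ideal $I=(a_1^{F_{\ell+2}},\,a_2^{F_{\ell+2}},\,a_1^{F_\ell}a_2^{F_{\ell+1}})$ of $A$ satisfies $$\mathrm{SD}(I)=\{F_2,F_3,\dots,F_{\ell+2}\},\qquad \mathrm{st}(I)=\ell+1,\qquad \mathrm{rt}(I)=F_{\ell+2},$$ and hence $$\mathrm{rt}(I)=F_{\mathrm{st}(I)+1}=\frac{\varphi^{\mathrm{st}(I)+1}-(-\varphi^{-1})^{\mathrm{st}(I)+1}}{\sqrt5}.$$ (2) For every integer $m\ge 1$ there is an ideal $I$ of $A$ with $\mathrm{st}(I)=m$. -/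

import Mathlib

/-! Equations of the Rees algebra of an ideal: effective relations, sifted degrees,
sifted type and relation type. -/

namespace Rees

noncomputable section

/-- The `A`-linear map `I → 𝓡(I) = ⨁ Iⁿ tⁿ ⊆ A[t]`, `x ↦ x t`. -/
def degreeOne {A : Type*} [CommRing A] (I : Ideal A) : I →ₗ[A] reesAlgebra I where
  toFun x := ⟨Polynomial.monomial 1 (x : A),
    reesAlgebra.monomial_mem.2 (by rw [pow_one]; exact x.2)⟩
  map_add' x y := Subtype.ext (by simp)
  map_smul' a x := Subtype.ext (by simp [Polynomial.smul_monomial])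

/-- The canonical surjective graded morphism `α : 𝐒(I) → 𝓡(I)` from the symmetric algebra of `I`
to the Rees algebra of `I`. -/
def alpha {A : Type*} [CommRing A] (I : Ideal A) : SymmetricAlgebra A I →ₐ[A] reesAlgebra I :=
  SymmetricAlgebra.lift (degreeOne I)

/-- The graded component `𝐒ₙ(I)` of the symmetric algebra: the `A`-span of the products of `n`
elements of `I`. -/
def symComponent {A : Type*} [CommRing A] (I : Ideal A) (n : ℕ) :
    Submodule A (SymmetricAlgebra A I) :=
  LinearMap.range (SymmetricAlgebra.ι A I) ^ n

/-- The kernel of the `n`-th graded component `αₙ : 𝐒ₙ(I) → Iⁿ` of `α`. -/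
def kerComponent {A : Type*} [CommRing A] (I : Ideal A) (n : ℕ) :
    Submodule A (SymmetricAlgebra A I) :=
  symComponent I n ⊓ LinearMap.ker (alpha I).toLinearMap

/-- The module of effective `n`-relations `E(I)ₙ = ker αₙ / 𝐒₁(I) · ker αₙ₋₁`
(meaningful for `n ≥ 2`). -/
abbrev EffectiveRelations {A : Type*} [CommRing A] (I : Ideal A) (n : ℕ) : Type _ :=
  kerComponent I n ⧸
    (symComponent I 1 * kerComponent I (n - 1)).submoduleOf (kerComponent I n)

/-- The set of sifted degrees `SD(I) = {1} ∪ {n ≥ 2 ∣ E(I)ₙ ≠ 0}`. -/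
def siftedDegrees {A : Type*} [CommRing A] (I : Ideal A) : Set ℕ :=
  {1} ∪ {n | 2 ≤ n ∧ Nontrivial (EffectiveRelations I n)}

/-- The sifted type `st(I)`: the number of sifted degrees. -/
def siftedType {A : Type*} [CommRing A] (I : Ideal A) : ℕ :=
  (siftedDegrees I).ncard

/-- The relation type `rt(I) = min {r ≥ 1 ∣ E(I)ₙ = 0 for all n ≥ r + 1}`. -/
def relationType {A : Type*} [CommRing A] (I : Ideal A) : ℕ :=
  sInf {r | 1 ≤ r ∧ ∀ n, r + 1 ≤ n → Subsingleton (EffectiveRelations I n)}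

/-- The ideal `(a₁^{F_{ℓ+2}}, a₂^{F_{ℓ+2}}, a₁^{F_ℓ} a₂^{F_{ℓ+1}})` of `k[a₁, a₂]`, where `F` is
the Fibonacci sequence. -/
def fibIdeal (k : Type*) [Field k] (ℓ : ℕ) : Ideal (MvPolynomial (Fin 2) k) :=
  Ideal.span {MvPolynomial.X 0 ^ Nat.fib (ℓ + 2), MvPolynomial.X 1 ^ Nat.fib (ℓ + 2),
    MvPolynomial.X 0 ^ Nat.fib ℓ * MvPolynomial.X 1 ^ Nat.fib (ℓ + 1)}

end

end Rees

/-! The kernel of A[T] → 𝐒(I) is generated by the linear Rees equations, so for n ≥ 2 the module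
E(I)ₙ measures the equations of degree n not generated by those of degree n - 1. For a monomial
ideal, equations are combinations of differences of two terms with the same image x^N tⁿ, and such a
difference is decomposable as soon as its terms share a variable Tᵢ. Thus E(I)ₙ is controlled by a
graph on each fiber: short paths through shared variables make it vanish
(`reesEquations_le_decomposable`), and an isolated vertex Tᵢⁿ beside another vertex makes it nonzero
(`not_subsingleton_effectiveRelations`).

For (x^(b+c), y^(b+c), x^b y^c) the only obstruction is T₂ⁿ facing some T₀^(n-m) T₁^m. They are
separated exactly when c n - (b+c) m, or its mirror image with b, is a strict record among
nonnegative residues: n is the denominator of a best one-sided approximation to c/(b+c). For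
F_{ℓ+1}/F_{ℓ+2} consecutive Fibonacci pairs form unimodular bases of ℤ² with residues of opposite
signs; coordinates in these bases show that the records are exactly F₂, …, F_{ℓ+2} (`isRecord_fib`,
`IsRecord.exists_fib`). -/

namespace Rees

noncomputable section

open MvPolynomial

/-! ### Effective relations through a presentation by polynomial rings -/

section Presentation

variable {A ι : Type*} [CommRing A]

/-- The presentation `A[Tᵢ] → 𝐒(I)`, `Tᵢ ↦ fᵢ`, of the symmetric algebra of the ideal generated by
the family `f`. -/
def symPres (f : ι → A) :
    MvPolynomial ι A →ₐ[A] SymmetricAlgebra A (Ideal.span (Set.range f)) :=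
  aeval fun i => SymmetricAlgebra.ι A (Ideal.span (Set.range f))
    ⟨f i, Ideal.subset_span (Set.mem_range_self i)⟩

/-- The presentation `A[Tᵢ] → A[t]`, `Tᵢ ↦ fᵢ t`, of the Rees algebra of the ideal generated by
the family `f`. -/
def reesPres (f : ι → A) : MvPolynomial ι A →ₐ[A] Polynomial A :=
  aeval fun i => Polynomial.monomial 1 (f i)

/-- The homogeneous equations of degree `n` of the Rees algebra. -/
def reesEquations (f : ι → A) (n : ℕ) : Submodule A (MvPolynomial ι A) :=
  homogeneousSubmodule ι A n ⊓ LinearMap.ker (reesPres f).toLinearMap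

theorem mem_reesEquations {f : ι → A} {n : ℕ} {P : MvPolynomial ι A} :
    P ∈ reesEquations f n ↔ P.IsHomogeneous n ∧ reesPres f P = 0 := Iff.rfl

theorem alpha_symPres (f : ι → A) (P : MvPolynomial ι A) :
    (alpha (Ideal.span (Set.range f)) (symPres f P) : Polynomial A) = reesPres f P := by
  have : (reesAlgebra (Ideal.span (Set.range f))).val.comp
      ((alpha (Ideal.span (Set.range f))).comp (symPres f)) = reesPres f := by
    refine MvPolynomial.algHom_ext fun i => ?_
    simp [symPres, reesPres, alpha, degreeOne]
  exact DFunLike.congr_fun this P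

theorem symComponent_eq_map (f : ι → A) (n : ℕ) :
    symComponent (Ideal.span (Set.range f)) n =
      (homogeneousSubmodule ι A n).map (symPres f).toLinearMap := by
  rw [← homogeneousSubmodule_one_pow, Submodule.map_pow, symComponent]
  congr 1
  rw [homogeneousSubmodule_one_eq_span_X, Submodule.map_span, ← Set.range_comp]
  apply le_antisymm
  · rintro _ ⟨⟨x, hx⟩, rfl⟩
    induction hx using Submodule.span_induction with
    | mem x hx =>
      obtain ⟨i, rfl⟩ := hx
      exact Submodule.subset_span ⟨i, by simp [symPres]⟩
    | zero => exact (congrArg (· ∈ _) (map_zero _)).mpr (zero_mem _)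
    | add x y hx hy ihx ihy =>
      have := add_mem ihx ihy
      rwa [← map_add] at this
    | smul a x hx ih =>
      have := Submodule.smul_mem _ a ih
      rwa [← map_smul] at this
  · rw [Submodule.span_le]
    rintro _ ⟨i, rfl⟩
    exact ⟨⟨f i, Ideal.subset_span (Set.mem_range_self i)⟩, by simp [symPres]⟩

theorem kerComponent_eq_map (f : ι → A) (n : ℕ) :
    kerComponent (Ideal.span (Set.range f)) n =
      (reesEquations f n).map (symPres f).toLinearMap := by
  rw [kerComponent, symComponent_eq_map]
  apply le_antisymm
  · rintro _ ⟨⟨P, hP, rfl⟩, h⟩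
    refine ⟨P, ⟨hP, ?_⟩, rfl⟩
    have h' : alpha (Ideal.span (Set.range f)) (symPres f P) = 0 := h
    have := alpha_symPres f P
    rw [h'] at this
    exact this.symm
  · rintro _ ⟨P, ⟨hP, h⟩, rfl⟩
    refine ⟨⟨P, hP, rfl⟩, ?_⟩
    have := alpha_symPres f P
    rw [show reesPres f P = 0 from h] at this
    exact Subtype.ext this

/-- The equations of degree `n` generated by those of degree `n - 1`. -/
def decomposableEquations (f : ι → A) (n : ℕ) : Submodule A (MvPolynomial ι A) :=
  homogeneousSubmodule ι A 1 * reesEquations f (n - 1)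

theorem symComponent_mul_kerComponent_eq_map (f : ι → A) (n : ℕ) :
    symComponent (Ideal.span (Set.range f)) 1 * kerComponent (Ideal.span (Set.range f)) (n - 1) =
      (decomposableEquations f n).map (symPres f).toLinearMap := by
  rw [symComponent_eq_map, kerComponent_eq_map, decomposableEquations, Submodule.map_mul]

/-- A-linear syzygies of `f` are linear Rees equations, so fᵢ ↦ Tᵢ is a well-defined linear map from
the ideal to A[T]/J. Its lift to the symmetric algebra, composed with `symPres f`, is the quotient
map; hence the kernel lies in J. -/
theorem mem_span_of_symPres_eq_zero (f : ι → A) {P : MvPolynomial ι A} (hP : symPres f P = 0) :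
    P ∈ Ideal.span (reesEquations f 1 : Set (MvPolynomial ι A)) := by
  set J := Ideal.span (reesEquations f 1 : Set (MvPolynomial ι A))
  set I := Ideal.span (Set.range f)
  let g : (ι →₀ A) →ₗ[A] I := (Finsupp.linearCombination A f).codRestrict I fun c => by
    have : Finsupp.linearCombination A f c ∈ Submodule.span A (Set.range f) := by
      rw [← Finsupp.range_linearCombination]; exact LinearMap.mem_range_self _ c
    exact this
  have hg : Function.Surjective g := by
    rintro ⟨x, hx⟩
    have : x ∈ Submodule.span A (Set.range f) := hx
    rw [← Finsupp.range_linearCombination] at this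
    obtain ⟨c, rfl⟩ := this
    exact ⟨c, rfl⟩
  let h : (ι →₀ A) →ₗ[A] MvPolynomial ι A ⧸ J :=
    (Ideal.Quotient.mkₐ A J).toLinearMap ∘ₗ
      Finsupp.linearCombination A (X : ι → MvPolynomial ι A)
  have hgh : LinearMap.ker g ≤ LinearMap.ker h := by
    intro c hc
    have hc' : Finsupp.linearCombination A f c = 0 := congrArg Subtype.val (LinearMap.mem_ker.1 hc)
    refine LinearMap.mem_ker.2 (Ideal.Quotient.eq_zero_iff_mem.2 (Ideal.subset_span ⟨?_, ?_⟩))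
    · rw [homogeneousSubmodule_one_eq_span_X, ← Finsupp.range_linearCombination]
      exact LinearMap.mem_range_self _ c
    · have : (reesPres f).toLinearMap ∘ₗ Finsupp.linearCombination A (X : ι → MvPolynomial ι A) =
          Polynomial.monomial 1 ∘ₗ Finsupp.linearCombination A f := by
        ext i : 2
        simp [reesPres]
      have := DFunLike.congr_fun this c
      simp only [LinearMap.comp_apply, hc', map_zero] at this
      exact this
  let φ : I →ₗ[A] MvPolynomial ι A ⧸ J :=
    (LinearMap.ker g).liftQ h hgh ∘ₗ (g.quotKerEquivOfSurjective hg).symm.toLinearMap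
  have hφ : ∀ c, φ (g c) = h c := fun c => by
    have : (g.quotKerEquivOfSurjective hg).symm (g c) = (LinearMap.ker g).mkQ c := by
      rw [LinearEquiv.symm_apply_eq]; rfl
    simp only [φ, LinearMap.comp_apply, LinearEquiv.coe_coe, this]
    rfl
  have key : (SymmetricAlgebra.lift φ).comp (symPres f) = Ideal.Quotient.mkₐ A J := by
    refine MvPolynomial.algHom_ext fun i => ?_
    have hi : (⟨f i, Ideal.subset_span (Set.mem_range_self i)⟩ : I) = g (Finsupp.single i 1) :=
      Subtype.ext (by simp [g])
    have : φ ⟨f i, Ideal.subset_span (Set.mem_range_self i)⟩ = Ideal.Quotient.mkₐ A J (X i) := by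
      rw [hi, hφ]; simp [h]
    rw [symPres, AlgHom.comp_apply, aeval_X]
    exact (SymmetricAlgebra.lift_ι_apply φ _).trans this
  have := DFunLike.congr_fun key P
  rw [AlgHom.comp_apply, hP, map_zero] at this
  exact Ideal.Quotient.eq_zero_iff_mem.1 this.symm

theorem subsingleton_effectiveRelations_iff (I : Ideal A) (n : ℕ) :
    Subsingleton (EffectiveRelations I n) ↔
      kerComponent I n ≤ symComponent I 1 * kerComponent I (n - 1) := by
  rw [EffectiveRelations, Submodule.Quotient.subsingleton_iff,
    Submodule.submoduleOf_eq_top]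

theorem subsingleton_effectiveRelations_of_le {f : ι → A} {n : ℕ}
    (h : reesEquations f n ≤ decomposableEquations f n) :
    Subsingleton (EffectiveRelations (Ideal.span (Set.range f)) n) := by
  rw [subsingleton_effectiveRelations_iff, kerComponent_eq_map,
    symComponent_mul_kerComponent_eq_map]
  exact Submodule.map_mono h

theorem exists_sub_mem_of_subsingleton {f : ι → A} {n : ℕ}
    (h : Subsingleton (EffectiveRelations (Ideal.span (Set.range f)) n))
    {P : MvPolynomial ι A} (hP : P ∈ reesEquations f n) :
    ∃ D ∈ decomposableEquations f n,
      P - D ∈ Ideal.span (reesEquations f 1 : Set (MvPolynomial ι A)) := by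
  rw [subsingleton_effectiveRelations_iff, kerComponent_eq_map,
    symComponent_mul_kerComponent_eq_map] at h
  obtain ⟨D, hD, hDP⟩ := h (Submodule.mem_map_of_mem hP)
  refine ⟨D, hD, mem_span_of_symPres_eq_zero f ?_⟩
  rw [map_sub, sub_eq_zero]
  exact hDP.symm

end Presentation

/-! ### Monomial ideals: fibers and shared variables -/

section Monomial

variable {σ ι k : Type*} [Field k]

/-- The monomials `x^{dᵢ}` with exponents in the family `d`. -/
def monomialGens (k : Type*) [Field k] (d : ι → σ →₀ ℕ) (i : ι) : MvPolynomial σ k :=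
  monomial (d i) 1

/-- The exponent of the monomial `∏ (x^{dᵢ})^{vᵢ}`. -/
def totalExp (d : ι → σ →₀ ℕ) : (ι →₀ ℕ) →ₗ[ℕ] (σ →₀ ℕ) :=
  Finsupp.linearCombination ℕ d

@[simp]
theorem totalExp_single (d : ι → σ →₀ ℕ) (i : ι) (n : ℕ) :
    totalExp d (Finsupp.single i n) = n • d i := by
  simp [totalExp]

theorem reesPres_monomial (d : ι → σ →₀ ℕ) (v : ι →₀ ℕ) (u : σ →₀ ℕ) (c : k) :
    reesPres (monomialGens k d) (monomial v (monomial u c)) =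
      Polynomial.monomial v.degree (monomial (u + totalExp d v) c) := by
  have key : v.prod (fun i e => Polynomial.monomial 1 (monomialGens k d i) ^ e) =
      Polynomial.monomial v.degree (monomial (totalExp d v) (1 : k)) := by
    induction v using Finsupp.induction_linear with
    | zero => simp
    | add v w hv hw =>
      rw [Finsupp.prod_add_index' (by simp) (by simp [pow_add]), hv, hw,
        Polynomial.monomial_mul_monomial, monomial_mul, map_add, map_add, one_mul]
    | single i n =>
      rw [Finsupp.prod_single_index (by simp), Polynomial.monomial_pow, monomialGens,
        monomial_pow]
      simp
  rw [reesPres, aeval_monomial, key, Polynomial.algebraMap_eq, Polynomial.C_mul_monomial,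
    monomial_mul, mul_one]

/-- The exponents `v` of degree `n` such that `∏ (x^{dᵢ})^{vᵢ}` divides `x^N`; they index the
monomials of `k[x][T]` of degree `n` in `T` that map to `x^N tⁿ`. -/
def fiber (d : ι → σ →₀ ℕ) (n : ℕ) (N : σ →₀ ℕ) : Set (ι →₀ ℕ) :=
  {v | v.degree = n ∧ totalExp d v ≤ N}

/-- Two monomials have a common variable. -/
def Meets (v w : ι →₀ ℕ) : Prop := ∃ i, v i ≠ 0 ∧ w i ≠ 0

/-- The multiple of `T^v` that maps to `c x^N tⁿ` when `v` lies in the fiber of `x^N tⁿ`. -/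
def fiberMonomial (d : ι → σ →₀ ℕ) (N : σ →₀ ℕ) (v : ι →₀ ℕ) (c : k) :
    MvPolynomial ι (MvPolynomial σ k) :=
  monomial v (monomial (N - totalExp d v) c)

theorem reesPres_fiberMonomial {d : ι → σ →₀ ℕ} {n : ℕ} {N : σ →₀ ℕ} {v : ι →₀ ℕ}
    (hv : v ∈ fiber d n N) (c : k) :
    reesPres (monomialGens k d) (fiberMonomial d N v c) =
      Polynomial.monomial n (monomial N c) := by
  rw [fiberMonomial, reesPres_monomial, tsub_add_cancel_of_le hv.2, hv.1]

theorem fiberMonomial_sub_mem {d : ι → σ →₀ ℕ} {n : ℕ} {N : σ →₀ ℕ} {v w : ι →₀ ℕ}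
    (hv : v ∈ fiber d n N) (hw : w ∈ fiber d n N) (c : k) :
    fiberMonomial d N v c - fiberMonomial d N w c ∈ reesEquations (monomialGens k d) n := by
  rw [mem_reesEquations]
  refine ⟨(isHomogeneous_monomial _ hv.1).sub (isHomogeneous_monomial _ hw.1), ?_⟩
  rw [map_sub, reesPres_fiberMonomial hv, reesPres_fiberMonomial hw, sub_self]

/-- The common variable factors out of both terms, leaving a difference in the fiber of x^(N - dᵢ)
in degree n - 1. -/
theorem fiberMonomial_sub_mem_decomposable {d : ι → σ →₀ ℕ} {n : ℕ} {N : σ →₀ ℕ}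
    {v w : ι →₀ ℕ} (hv : v ∈ fiber d n N) (hw : w ∈ fiber d n N) (h : Meets v w) (c : k) :
    fiberMonomial d N v c - fiberMonomial d N w c ∈
      decomposableEquations (monomialGens k d) n := by
  obtain ⟨i, hvi, hwi⟩ := h
  have split : ∀ z ∈ fiber d n N, z i ≠ 0 → ∃ z' ∈ fiber d (n - 1) (N - d i),
      fiberMonomial d N z c = X i * fiberMonomial d (N - d i) z' c := by
    rintro z ⟨hz, hzN⟩ hzi
    have hle : Finsupp.single i 1 ≤ z := by
      rw [Finsupp.single_le_iff]; exact Nat.one_le_iff_ne_zero.2 hzi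
    obtain ⟨z', rfl⟩ := exists_add_of_le hle
    rw [map_add, totalExp_single, one_smul] at hzN
    refine ⟨z', ⟨?_, le_tsub_of_add_le_left hzN⟩, ?_⟩
    · rw [← hz, map_add]; simp
    · rw [fiberMonomial, fiberMonomial, X, monomial_mul, one_mul, map_add, totalExp_single,
        one_smul, tsub_add_eq_tsub_tsub]
  obtain ⟨v', hv', ev⟩ := split v hv hvi
  obtain ⟨w', hw', ew⟩ := split w hw hwi
  rw [ev, ew, ← mul_sub]
  exact Submodule.mul_mem_mul (isHomogeneous_X _ i) (fiberMonomial_sub_mem hv' hw' c)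

theorem reesEquations_le_decomposable {d : ι → σ →₀ ℕ} {n : ℕ}
    (h : ∀ N, ∀ v ∈ fiber d n N, ∀ w ∈ fiber d n N, ∃ z ∈ fiber d n N, Meets v z ∧ Meets z w) :
    reesEquations (monomialGens k d) n ≤ decomposableEquations (monomialGens k d) n := by
  classical
  let s : (σ →₀ ℕ) → (ι →₀ ℕ) := fun N =>
    if hN : (fiber d n N).Nonempty then hN.choose else 0
  have hs : ∀ N, ∀ v ∈ fiber d n N, s N ∈ fiber d n N := fun N v hv => by
    have hN : (fiber d n N).Nonempty := ⟨v, hv⟩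
    simp only [s, dif_pos hN]
    exact hN.choose_spec
  let θ : MvPolynomial σ k →ₗ[k] MvPolynomial ι (MvPolynomial σ k) :=
    (basisMonomials σ k).constr k fun N => fiberMonomial d N (s N) (1 : k)
  have hθ : ∀ N c, θ (monomial N c) = fiberMonomial d N (s N) c := fun N c => by
    have h1 : θ (monomial N 1) = fiberMonomial d N (s N) 1 := by
      simpa using (basisMonomials σ k).constr_basis k
        (fun N => fiberMonomial d N (s N) (1 : k)) N
    rw [show monomial N c = c • monomial N (1 : k) by rw [smul_monomial, smul_eq_mul, mul_one],
      map_smul, h1, fiberMonomial, fiberMonomial, smul_monomial, smul_monomial, smul_eq_mul,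
      mul_one]
  -- `θ` sends x^N to a chosen representative of its fiber, so `L` fixes every equation of degree n,
  -- while `L` of a single term is a difference inside one fiber.
  let L : MvPolynomial ι (MvPolynomial σ k) → MvPolynomial ι (MvPolynomial σ k) := fun P =>
    P - θ ((reesPres (monomialGens k d) P).coeff n)
  have L_add : ∀ P Q, L (P + Q) = L P + L Q := fun P Q => by
    simp only [L, map_add, Polynomial.coeff_add]; abel
  have L_mon : ∀ v : ι →₀ ℕ, v.degree = n → ∀ a, L (monomial v a) ∈
      decomposableEquations (monomialGens k d) n := by
    intro v hv a
    induction a using MvPolynomial.induction_on' with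
    | monomial u c =>
      have hvN : v ∈ fiber d n (u + totalExp d v) := ⟨hv, self_le_add_left _ _⟩
      obtain ⟨z, hz, hvz, hzs⟩ := h _ v hvN _ (hs _ v hvN)
      have := add_mem (fiberMonomial_sub_mem_decomposable hvN hz hvz c)
        (fiberMonomial_sub_mem_decomposable hz (hs _ v hvN) hzs c)
      rw [sub_add_sub_cancel] at this
      simp only [L]
      rw [reesPres_monomial, hv, Polynomial.coeff_monomial_same, hθ]
      rwa [show fiberMonomial d (u + totalExp d v) v c = monomial v (monomial u c) by
        rw [fiberMonomial, add_tsub_cancel_right]] at this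
    | add p q hp hq => rw [map_add, L_add]; exact add_mem hp hq
  intro P hP
  rw [mem_reesEquations] at hP
  have hL : L P = P := by simp [L, hP.2]
  have hsum : ∀ S : Finset (ι →₀ ℕ), S ⊆ P.support →
      L (∑ v ∈ S, monomial v (coeff v P)) ∈ decomposableEquations (monomialGens k d) n := by
    intro S
    induction S using Finset.induction_on with
    | empty => intro _; simp [L]
    | insert v S hv ih =>
      intro hS
      rw [Finset.sum_insert hv, L_add]
      refine add_mem (L_mon v ?_ _) (ih fun x hx => hS (Finset.mem_insert_of_mem hx))
      have := hP.1 (mem_support_iff.1 (hS (Finset.mem_insert_self v S)))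
      rw [Finsupp.degree_eq_weight_one]
      exact this
  have := hsum P.support subset_rfl
  rwa [← as_sum, hL] at this

/-- The witness is the difference of the terms at Tᵢⁿ and `w`. The coefficient `Λ` of x^(N - n dᵢ)
Tᵢⁿ is 1 on it, but vanishes on decomposable equations and on the ideal of linear ones. -/
theorem not_subsingleton_effectiveRelations {d : ι → σ →₀ ℕ} {n : ℕ} (hn : 2 ≤ n) (i : ι)
    {N : σ →₀ ℕ} (hi : Finsupp.single i n ∈ fiber d n N) {w : ι →₀ ℕ} (hw : w ∈ fiber d n N)
    (hwi : w i = 0) (huniq : ∀ z ∈ fiber d n N, z i ≠ 0 → z = Finsupp.single i n) :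
    ¬ Subsingleton (EffectiveRelations (Ideal.span (Set.range (monomialGens k d))) n) := by
  classical
  intro hsub
  let Λ : MvPolynomial ι (MvPolynomial σ k) → k := fun P =>
    coeff (N - n • d i) (coeff (Finsupp.single i n) P)
  have Λ_add : ∀ P Q, Λ (P + Q) = Λ P + Λ Q := fun P Q => by simp [Λ]
  have hdN : n • d i ≤ N := by simpa using hi.2
  have hnd : n • d i = d i + (n - 1) • d i := by
    rw [← succ_nsmul']; congr 1; omega
  have hsn : Finsupp.single i n = Finsupp.single i 1 + Finsupp.single i (n - 1) := by
    rw [← Finsupp.single_add]; congr 1; omega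
  have hdi : d i ≤ N := (hnd ▸ self_le_add_right _ _ : d i ≤ n • d i).trans hdN
  -- By isolation, Tᵢ^(n-1) is alone in the fiber of x^(N - dᵢ) in degree n - 1, so no other term
  -- contributes to that coefficient of the image.
  have coeff_eq : ∀ P, coeff (N - d i) ((reesPres (monomialGens k d) P).coeff (n - 1)) =
      coeff (N - n • d i) (coeff (Finsupp.single i (n - 1)) P) := by
    intro P
    induction P using MvPolynomial.induction_on' with
    | monomial v a =>
      induction a using MvPolynomial.induction_on' with
      | monomial u c =>
        rw [reesPres_monomial, Polynomial.coeff_monomial, coeff_monomial]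
        by_cases hv : v = Finsupp.single i (n - 1)
        · subst hv
          have : N - n • d i = N - d i - (n - 1) • d i := by rw [hnd, tsub_add_eq_tsub_tsub]
          have hle : (n - 1) • d i ≤ N - d i := le_tsub_of_add_le_left (hnd ▸ hdN)
          rw [if_pos (Finsupp.degree_single _ _), if_pos rfl, totalExp_single, coeff_monomial, coeff_monomial, this]
          refine if_congr ⟨fun e => ?_, fun e => ?_⟩ rfl rfl
          · rw [← e, add_tsub_cancel_right]
          · rw [e, tsub_add_cancel_of_le hle]
        · rw [if_neg hv, coeff_zero]
          split_ifs with hdeg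
          · rw [coeff_monomial, if_neg]
            intro e
            refine hv (add_left_cancel (a := Finsupp.single i 1) ?_)
            rw [← hsn]
            refine huniq _ ⟨?_, ?_⟩ (by simp)
            · rw [map_add, hdeg]; simp; omega
            · rw [map_add, totalExp_single, one_smul, ← tsub_add_cancel_of_le hdi, add_comm, ← e]
              exact add_le_add_left (self_le_add_left _ _) _
          · rw [coeff_zero]
      | add p q hp hq => simp only [map_add, Polynomial.coeff_add, coeff_add, hp, hq]
    | add p q hp hq => simp only [map_add, Polynomial.coeff_add, coeff_add, hp, hq]
  have Λ_X_mul : ∀ P, reesPres (monomialGens k d) P = 0 → ∀ l, Λ (X l * P) = 0 := by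
    intro P hP l
    simp only [Λ]
    by_cases hl : l = i
    · subst hl
      rw [hsn, coeff_X_mul, ← coeff_eq, hP]
      simp
    · rw [coeff_X_mul', if_neg]
      · simp
      · simp [Ne.symm hl]
  have Λ_span : ∀ P ∈ Ideal.span (reesEquations (monomialGens k d) 1 : Set _), Λ P = 0 := by
    have aux : ∀ P ∈ reesEquations (monomialGens k d) 1, ∀ g, Λ (g * P) = 0 := by
      intro P hP g
      rw [mem_reesEquations] at hP
      induction g using MvPolynomial.induction_on with
      | C a =>
        simp only [Λ]
        -- A linear form has no Tᵢⁿ term because n ≥ 2.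
        rw [coeff_C_mul, hP.1.coeff_eq_zero, mul_zero, coeff_zero]
        simp; omega
      | add p q hp hq => rw [add_mul, Λ_add, hp, hq, add_zero]
      | mul_X p l _ =>
        rw [mul_comm p, mul_assoc]
        exact Λ_X_mul _ (by rw [map_mul, hP.2, mul_zero]) l
    intro P hP
    have : ∀ g, Λ (g * P) = 0 := by
      induction hP using Submodule.span_induction with
      | mem x hx => exact aux x hx
      | zero => intro g; simp [Λ]
      | add x y _ _ hx hy => intro g; rw [mul_add, Λ_add, hx, hy, add_zero]
      | smul a x _ hx => intro g; rw [smul_eq_mul, ← mul_assoc]; exact hx _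
    simpa using this 1
  have Λ_dec : ∀ D ∈ decomposableEquations (monomialGens k d) n, Λ D = 0 := by
    intro D hD
    induction hD using Submodule.mul_induction_on' with
    | mem_mul_mem h hh q hq =>
      have hq' := (mem_reesEquations.1 hq).2
      rw [homogeneousSubmodule_one_eq_span_X] at hh
      have : ∀ a : MvPolynomial σ k, Λ ((a • h) * q) = 0 := by
        induction hh using Submodule.span_induction with
        | mem x hx =>
          obtain ⟨l, rfl⟩ := hx
          intro a
          rw [smul_mul_assoc, ← mul_smul_comm]
          exact Λ_X_mul _ (by rw [map_smul, hq', smul_zero]) l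
        | zero => intro a; simp [Λ]
        | add x y _ _ hx hy => intro a; rw [smul_add, add_mul, Λ_add, hx, hy, add_zero]
        | smul b x _ hx => intro a; rw [smul_smul]; exact hx _
      simpa using this 1
    | add x _ y _ hx hy => rw [Λ_add, hx, hy, add_zero]
  obtain ⟨D, hD, hPD⟩ := exists_sub_mem_of_subsingleton hsub (fiberMonomial_sub_mem hi hw (1 : k))
  have h1 := Λ_add D (fiberMonomial d N (Finsupp.single i n) 1 - fiberMonomial d N w 1 - D)
  rw [add_sub_cancel, Λ_dec D hD, Λ_span _ hPD, add_zero] at h1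
  have hne : w ≠ Finsupp.single i n := by
    rintro rfl
    simp at hwi; omega
  simp [Λ, fiberMonomial, coeff_monomial, hne] at h1

end Monomial

/-! ### Three generators in two variables: reduction to record residues -/

section ThreeGenerators

/-- The exponents of the monomials `x^(b+c)`, `y^(b+c)`, `x^b y^c`. -/
def threeExp (b c : ℕ) : Fin 3 → Fin 2 →₀ ℕ :=
  ![Finsupp.single 0 (b + c), Finsupp.single 1 (b + c), Finsupp.single 0 b + Finsupp.single 1 c]

/-- The ideal `(x^(b+c), y^(b+c), x^b y^c)`. -/
def threeIdeal (k : Type*) [Field k] (b c : ℕ) : Ideal (MvPolynomial (Fin 2) k) :=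
  Ideal.span (Set.range (monomialGens k (threeExp b c)))

theorem fibIdeal_eq (k : Type*) [Field k] (ℓ : ℕ) :
    fibIdeal k ℓ = threeIdeal k (Nat.fib ℓ) (Nat.fib (ℓ + 1)) := by
  have : monomialGens k (threeExp (Nat.fib ℓ) (Nat.fib (ℓ + 1))) =
      ![X 0 ^ Nat.fib (ℓ + 2), X 1 ^ Nat.fib (ℓ + 2),
        X 0 ^ Nat.fib ℓ * X 1 ^ Nat.fib (ℓ + 1)] := by
    ext1 i
    fin_cases i <;>
      simp [monomialGens, threeExp, X_pow_eq_monomial, Nat.fib_add_two, monomial_mul]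
  rw [fibIdeal, threeIdeal, this]
  congr 1
  ext f
  simp [or_comm, or_left_comm]

theorem mem_fiber_threeExp {b c n : ℕ} {N : Fin 2 →₀ ℕ} {v : Fin 3 →₀ ℕ} :
    v ∈ fiber (threeExp b c) n N ↔ v 0 + v 1 + v 2 = n ∧ (b + c) * v 0 + b * v 2 ≤ N 0 ∧
      (b + c) * v 1 + c * v 2 ≤ N 1 := by
  rw [fiber, Set.mem_ofPred_eq, Finsupp.degree_eq_sum, Fin.sum_univ_three, Finsupp.le_def,
    Fin.forall_fin_two]
  simp [totalExp, Finsupp.linearCombination_apply, Finsupp.sum_fintype, Fin.sum_univ_three,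
    threeExp, mul_comm (v _), add_mul]

theorem exists_mem_fiber_threeExp {b c n : ℕ} {N : Fin 2 →₀ ℕ} {p q r : ℕ} (h : p + q + r = n)
    (h0 : (b + c) * p + b * r ≤ N 0) (h1 : (b + c) * q + c * r ≤ N 1) :
    ∃ v ∈ fiber (threeExp b c) n N, v 0 = p ∧ v 1 = q ∧ v 2 = r :=
  ⟨Finsupp.equivFunOnFinite.symm ![p, q, r], mem_fiber_threeExp.2 ⟨h, h0, h1⟩, rfl, rfl, rfl⟩

/-- The nonnegative residue `x n - a m` is smaller than every nonnegative residue `x s - a m'`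
with `1 ≤ s < n`. -/
def IsRecord (x a n m : ℕ) : Prop :=
  a * m ≤ x * n ∧ ∀ s m', 1 ≤ s → s < n → a * m' ≤ x * s → x * n + a * m' < x * s + a * m

theorem exists_of_not_isRecord {x a n m : ℕ} (hxa : x ≤ a) (ha : 0 < a) (hm : a * m ≤ x * n)
    (h : ¬ IsRecord x a n m) :
    ∃ p q r, p + q + r = n ∧ 1 ≤ p + q ∧ 1 ≤ r ∧ a * q ≤ x * (p + q) ∧
      x * (p + q) + a * m ≤ x * n + a * q := by
  simp only [IsRecord, not_and, not_forall, not_lt] at h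
  obtain ⟨s, q, h1, h2, h3, h4⟩ := h hm
  have hqs : q ≤ s := le_of_mul_le_mul_left (h3.trans (Nat.mul_le_mul_right s hxa)) ha
  obtain ⟨p, rfl⟩ := exists_add_of_le hqs
  refine ⟨p, q, n - (q + p), by omega, by omega, by omega, ?_, ?_⟩ <;> rwa [add_comm p q]

theorem exists_meets {b c n : ℕ} (hbc : 0 < b + c) (hn : 2 ≤ n)
    (hrec : ∀ m, ¬ IsRecord c (b + c) n m ∧ ¬ IsRecord b (b + c) n m) {N : Fin 2 →₀ ℕ}
    {v w : Fin 3 →₀ ℕ} (hv : v ∈ fiber (threeExp b c) n N) (hw : w ∈ fiber (threeExp b c) n N)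
    (hw2 : w 2 = 0) :
    ∃ z ∈ fiber (threeExp b c) n N, Meets v z ∧ Meets z w := by
  have hv' := mem_fiber_threeExp.1 hv
  have hw' := mem_fiber_threeExp.1 hw
  rw [hw2] at hw'
  obtain ⟨hvn, hv0, hv1⟩ := hv'
  obtain ⟨hwn, hw0, hw1⟩ := hw'
  by_cases h0 : v 0 ≠ 0 ∧ w 0 ≠ 0
  · exact ⟨w, hw, ⟨0, h0⟩, ⟨0, h0.2, h0.2⟩⟩
  by_cases h1 : v 1 ≠ 0 ∧ w 1 ≠ 0
  · exact ⟨w, hw, ⟨1, h1⟩, ⟨1, h1.2, h1.2⟩⟩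
  by_cases hw0z : w 0 = 0
  · have hw1n : w 1 = n := by omega
    have hv1z : v 1 = 0 := by omega
    rw [hw1n] at hw1
    by_cases hv2 : v 2 = 0
    · obtain ⟨z, hz, z0, z1, z2⟩ := exists_mem_fiber_threeExp (b := b) (c := c) (n := n) (N := N)
        (p := n - 1) (q := 1) (r := 0) (by omega)
        (by
          have : (b + c) * (n - 1) ≤ (b + c) * v 0 := Nat.mul_le_mul_left _ (by omega)
          omega)
        (by
          have : (b + c) * 1 ≤ (b + c) * n := Nat.mul_le_mul_left _ (by omega)
          omega)
      exact ⟨z, hz, ⟨0, by omega, by omega⟩, ⟨1, by omega, by omega⟩⟩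
    -- Here w = T₁ⁿ; trading one T₂ of `v` for T₁ gives a neighbour of both.
    · obtain ⟨r, hr⟩ := Nat.exists_eq_succ_of_ne_zero hv2
      obtain ⟨z, hz, z0, z1, z2⟩ := exists_mem_fiber_threeExp (b := b) (c := c) (n := n) (N := N)
        (p := v 0) (q := 1) (r := r) (by omega)
        (by rw [hr] at hv0; linarith)
        (by
          have : c * r ≤ (b + c) * r := Nat.mul_le_mul_right _ (by omega)
          have : (b + c) * (1 + r) ≤ (b + c) * n := Nat.mul_le_mul_left _ (by omega)
          linarith)
      refine ⟨z, hz, ?_, ⟨1, by omega, by omega⟩⟩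
      by_cases hv0z : v 0 = 0
      · exact ⟨2, by omega, by omega⟩
      · exact ⟨0, by omega, by omega⟩
  by_cases hw1z : w 1 = 0
  · have hw0n : w 0 = n := by omega
    have hv0z : v 0 = 0 := by omega
    rw [hw0n] at hw0
    by_cases hv2 : v 2 = 0
    · obtain ⟨z, hz, z0, z1, z2⟩ := exists_mem_fiber_threeExp (b := b) (c := c) (n := n) (N := N)
        (p := 1) (q := n - 1) (r := 0) (by omega)
        (by
          have : (b + c) * 1 ≤ (b + c) * n := Nat.mul_le_mul_left _ (by omega)
          omega)
        (by
          have : (b + c) * (n - 1) ≤ (b + c) * v 1 := Nat.mul_le_mul_left _ (by omega)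
          omega)
      exact ⟨z, hz, ⟨1, by omega, by omega⟩, ⟨0, by omega, by omega⟩⟩
    · obtain ⟨r, hr⟩ := Nat.exists_eq_succ_of_ne_zero hv2
      obtain ⟨z, hz, z0, z1, z2⟩ := exists_mem_fiber_threeExp (b := b) (c := c) (n := n) (N := N)
        (p := 1) (q := v 1) (r := r) (by omega)
        (by
          have : b * r ≤ (b + c) * r := Nat.mul_le_mul_right _ (by omega)
          have : (b + c) * (1 + r) ≤ (b + c) * n := Nat.mul_le_mul_left _ (by omega)
          linarith)
        (by rw [hr] at hv1; linarith)
      refine ⟨z, hz, ?_, ⟨0, by omega, by omega⟩⟩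
      by_cases hv1z : v 1 = 0
      · exact ⟨2, by omega, by omega⟩
      · exact ⟨1, by omega, by omega⟩
  -- What remains is v = T₂ⁿ against w = T₀^(w 0) T₁^(w 1) with both exponents positive. Only here
  -- is the absence of records needed.
  have hv0z : v 0 = 0 := by omega
  have hv1z : v 1 = 0 := by omega
  have hv2 : v 2 = n := by omega
  rw [hv2, hv0z] at hv0
  rw [hv2, hv1z] at hv1
  suffices h : ∃ p q r, p + q + r = n ∧ 1 ≤ p + q ∧ 1 ≤ r ∧ (b + c) * p + b * r ≤ N 0 ∧
      (b + c) * q + c * r ≤ N 1 by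
    obtain ⟨p, q, r, hpqr, hpq, hr, hp', hq'⟩ := h
    obtain ⟨z, hz, z0, z1, z2⟩ := exists_mem_fiber_threeExp hpqr hp' hq'
    refine ⟨z, hz, ⟨2, by omega, by omega⟩, ?_⟩
    by_cases hp : p = 0
    · exact ⟨1, by omega, by omega⟩
    · exact ⟨0, by omega, by omega⟩
  have hn' : w 0 + w 1 = n := by omega
  -- The sign of c n - (b+c) w₁ decides whether the residue of c or that of b is nonnegative. A
  -- smaller residue at s = p + q < n gives T₀^p T₁^q T₂^(n-s): as the total exponent is fixed at
  -- (b+c) n, the two residue inequalities are its two divisibility bounds.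
  rcases le_total ((b + c) * w 1) (c * n) with hle | hle
  · obtain ⟨p, q, r, hpqr, hpq, hr, h2, h3⟩ :=
      exists_of_not_isRecord (by omega) hbc hle (hrec _).1
    refine ⟨p, q, r, hpqr, hpq, hr, ?_, ?_⟩
    · have e1 : (b + c) * (p + q + r) = (b + c) * (w 0 + w 1) := by rw [hpqr, hn']
      rw [← hpqr] at h3
      linarith
    · rw [← hpqr] at hv1
      linarith
  · have hle' : (b + c) * w 0 ≤ b * n := by
      rw [← hn'] at hle ⊢
      linarith
    obtain ⟨q, p, r, hpqr, hpq, hr, h2, h3⟩ :=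
      exists_of_not_isRecord (by omega) hbc hle' (hrec _).2
    refine ⟨p, q, r, by omega, by omega, hr, ?_, ?_⟩
    · rw [← hpqr] at hv0
      linarith
    · have e1 : (b + c) * (q + p + r) = (b + c) * (w 0 + w 1) := by rw [hpqr, hn']
      rw [← hpqr] at h3
      linarith

theorem nontrivial_effectiveRelations_threeIdeal_iff (k : Type*) [Field k] {b c n : ℕ}
    (hbc : 0 < b + c) (hn : 2 ≤ n) :
    Nontrivial (EffectiveRelations (threeIdeal k b c) n) ↔
      ∃ m, IsRecord c (b + c) n m ∨ IsRecord b (b + c) n m := by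
  have hN : ∀ i j, ∃ N : Fin 2 →₀ ℕ, N 0 = i ∧ N 1 = j := fun i j =>
    ⟨Finsupp.equivFunOnFinite.symm ![i, j], rfl, rfl⟩
  rw [← not_subsingleton_iff_nontrivial]
  constructor
  · contrapose!
    intro hrec
    refine subsingleton_effectiveRelations_of_le (reesEquations_le_decomposable ?_)
    intro N v hv w hw
    by_cases hw2 : w 2 = 0
    · exact exists_meets hbc hn hrec hv hw hw2
    · by_cases hv2 : v 2 = 0
      · obtain ⟨z, hz, ⟨i, hi⟩, ⟨j, hj⟩⟩ := exists_meets hbc hn hrec hw hv hv2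
        exact ⟨z, hz, ⟨j, hj.symm⟩, ⟨i, hi.symm⟩⟩
      · exact ⟨v, hv, ⟨2, hv2, hv2⟩, ⟨2, hv2, hw2⟩⟩
  · have aux : ∀ {p q i j : ℕ}, p + q = n → (b + c) * p ≤ i → (b + c) * q ≤ j → b * n ≤ i →
        c * n ≤ j → (∀ p' q' r, p' + q' + r = n → 1 ≤ r → (b + c) * p' + b * r ≤ i →
          (b + c) * q' + c * r ≤ j → p' + q' = 0) →
        ¬ Subsingleton (EffectiveRelations (threeIdeal k b c) n) := by
      intro p q i j hpq h1 h2 h3 h4 h5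
      obtain ⟨N, rfl, rfl⟩ := hN i j
      obtain ⟨w, hw, hw0, hw1, hw2⟩ := exists_mem_fiber_threeExp (r := 0) hpq (by simpa) (by simpa)
      refine not_subsingleton_effectiveRelations hn 2 ?_ hw hw2 fun z hz hz2 => ?_
      · rw [mem_fiber_threeExp]; simp [h3, h4]
      · rw [mem_fiber_threeExp] at hz
        have := h5 _ _ _ hz.1 (Nat.one_le_iff_ne_zero.2 hz2) hz.2.1 hz.2.2
        ext i
        fin_cases i <;> simp <;> omega
    have le_n : ∀ {x m}, x ≤ b + c → (b + c) * m ≤ x * n → m ≤ n := fun hx h =>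
      le_of_mul_le_mul_left (h.trans (Nat.mul_le_mul_right n hx)) hbc
    rintro ⟨m, h | h⟩
    -- x^N is taken to be the lcm of the images of T₂ⁿ and T₀^e T₁^m, the smallest fiber containing
    -- both. Another member involving T₂ would be a residue breaking the record.
    · obtain ⟨e, he⟩ := exists_add_of_le (le_n (by omega) h.1)
      have h1 := h.1
      refine aux (p := e) (q := m) (by omega) le_rfl h1 (by subst he; nlinarith) le_rfl ?_
      intro p q r hpqr hr hi hj
      by_contra hne
      have := h.2 (p + q) q (by omega) (by omega) (by rw [← hpqr] at hj; linarith)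
      have e1 : (b + c) * (p + q + r) = (b + c) * (m + e) := by rw [hpqr, he]
      rw [← hpqr] at this
      linarith
    · obtain ⟨e, he⟩ := exists_add_of_le (le_n (by omega) h.1)
      have h1 := h.1
      refine aux (p := m) (q := e) (by omega) h1 le_rfl le_rfl (by subst he; nlinarith) ?_
      intro p q r hpqr hr hi hj
      by_contra hne
      have := h.2 (p + q) p (by omega) (by omega) (by rw [← hpqr] at hi; linarith)
      have e1 : (b + c) * (p + q + r) = (b + c) * (m + e) := by rw [hpqr, he]
      rw [← hpqr] at this
      linarith

end ThreeGenerators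

/-! ### Record residues of Fibonacci ratios -/

section Fibonacci

theorem fib_cross (i u : ℕ) :
    (Nat.fib (i + u) : ℤ) * Nat.fib (i + 1) - Nat.fib (i + u + 1) * Nat.fib i =
      (-1) ^ i * Nat.fib u := by
  induction i with
  | zero => simp
  | succ i ih =>
    have h1 : (Nat.fib (i + 2) : ℤ) = Nat.fib i + Nat.fib (i + 1) := by
      exact_mod_cast Nat.fib_add_two
    have h2 : (Nat.fib (i + u + 2) : ℤ) = Nat.fib (i + u) + Nat.fib (i + u + 1) := by
      exact_mod_cast Nat.fib_add_two
    rw [show i + 1 + u = i + u + 1 by ring, show i + u + 1 + 1 = i + u + 2 by ring,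
      show i + 1 + 1 = i + 2 by ring, h1, h2, pow_succ]
    linear_combination -ih

/-- Coordinates with respect to a basis of `ℤ²` given by a unimodular matrix. -/
theorem exists_unimodular_coords {P P' Q Q' η : ℤ} (hη : η = 1 ∨ η = -1)
    (hdet : P * Q' - Q * P' = η) (s M : ℤ) : ∃ x y, s = x * P + y * P' ∧ M = x * Q + y * Q' := by
  have hη2 : η * η = 1 := by rcases hη with rfl | rfl <;> norm_num
  refine ⟨η * (s * Q' - M * P'), η * (M * P - s * Q), ?_, ?_⟩
  · linear_combination -s * hη2 - s * η * hdet
  · linear_combination -M * hη2 - M * η * hdet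

/-- In the basis (P, Q), (P', Q') the signed residue is x D - y D'. With 0 < s < P, a positive y
forces x ≤ 0 and a negative residue, y = 0 is impossible, and y < 0 forces x ≥ 1, so the residue is
at least D + D'. D = 0 is allowed, to cover the final convergent. -/
theorem lt_of_lt_basis {P P' Q Q' η c a D D' : ℤ} (hη : η = 1 ∨ η = -1)
    (hdet : P * Q' - Q * P' = η) (hD : η * (c * P - a * Q) = D) (hD' : η * (c * P' - a * Q') = -D')
    (hP : 0 < P) (hP' : 0 < P') (hD0 : 0 ≤ D) (hD0' : 0 < D') {s M : ℤ} (hs : 0 < s)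
    (hsP : s < P) (hM : 0 ≤ η * (c * s - a * M)) : D < η * (c * s - a * M) := by
  obtain ⟨x, y, rfl, rfl⟩ := exists_unimodular_coords hη hdet s M
  have e : η * (c * (x * P + y * P') - a * (x * Q + y * Q')) = x * D - y * D' := by
    linear_combination x * hD + y * hD'
  rw [e] at hM ⊢
  rcases lt_trichotomy y 0 with hy | hy | hy
  · have hx : 0 < x := by by_contra hx; nlinarith
    nlinarith
  · subst hy
    have hx : 0 < x := by by_contra hx; nlinarith
    nlinarith
  · have hx : x ≤ 0 := by by_contra hx; nlinarith
    nlinarith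

/-- Strictly between P and P + P', the same coordinates have either x ≥ 2 and y < 0, or x ≤ 0 and y
> 0. So no new record appears there on either side. -/
theorem le_or_le_of_between {P P' Q Q' η c a D D' : ℤ} (hη : η = 1 ∨ η = -1)
    (hdet : P * Q' - Q * P' = η) (hD : η * (c * P - a * Q) = D) (hD' : η * (c * P' - a * Q') = -D')
    (hP' : 0 < P') (hPP' : P' ≤ P) (hD0 : 0 < D) (hD0' : 0 < D') {n M : ℤ} (hn : P < n)
    (hn' : n < P + P') : D ≤ η * (c * n - a * M) ∨ η * (c * n - a * M) ≤ -D' := by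
  obtain ⟨x, y, rfl, rfl⟩ := exists_unimodular_coords hη hdet n M
  have e : η * (c * (x * P + y * P') - a * (x * Q + y * Q')) = x * D - y * D' := by
    linear_combination x * hD + y * hD'
  rw [e]
  rcases lt_trichotomy y 0 with hy | hy | hy
  · have hx : 1 < x := by by_contra hx; nlinarith
    left; nlinarith
  · subst hy
    have hx : 1 < x := by by_contra hx; nlinarith
    nlinarith
  · have hx : x ≤ 0 := by by_contra hx; nlinarith
    right; nlinarith

theorem exists_fib_le_lt {n : ℕ} (hn : 1 ≤ n) : ∀ ℓ, n < Nat.fib (ℓ + 2) →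
    ∃ j < ℓ, Nat.fib (j + 2) ≤ n ∧ n < Nat.fib (j + 3)
  | 0, h => by simp at h; omega
  | ℓ + 1, h => by
    by_cases h' : n < Nat.fib (ℓ + 2)
    · obtain ⟨j, hj, hj'⟩ := exists_fib_le_lt hn ℓ h'
      exact ⟨j, by omega, hj'⟩
    · exact ⟨ℓ, by omega, not_lt.1 h', h⟩

/-- At s = a the residue is already 0 and cannot be beaten. -/
theorem IsRecord.le {x a n m : ℕ} (ha : 0 < a) (h : IsRecord x a n m) : n ≤ a := by
  by_contra hlt
  have h1 := h.1
  have := h.2 a x ha (by omega) (by rw [mul_comm])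
  nlinarith

theorem fib_basis (j t : ℕ) :
    (Nat.fib (j + 2) * Nat.fib j - Nat.fib (j + 1) * Nat.fib (j + 1) : ℤ) = (-1) ^ (j + 1) ∧
    (-1) ^ (j + 1) * (Nat.fib (j + t + 1) * Nat.fib (j + 2) -
      Nat.fib (j + t + 2) * Nat.fib (j + 1) : ℤ) = Nat.fib t ∧
    (-1) ^ (j + 1) * (Nat.fib (j + t + 1) * Nat.fib (j + 1) -
      Nat.fib (j + t + 2) * Nat.fib j : ℤ) = -Nat.fib (t + 1) := by
  have f1 := fib_cross (j + 1) t
  have f2 := fib_cross j (t + 1)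
  have f3 := fib_cross j 1
  rw [show j + 1 + t = j + t + 1 by ring, show j + t + 1 + 1 = j + t + 2 by ring,
    show j + 1 + 1 = j + 2 by ring] at f1
  rw [show j + (t + 1) = j + t + 1 by ring, show j + t + 1 + 1 = j + t + 2 by ring] at f2
  rw [show j + 1 + 1 = j + 2 by ring, Nat.fib_one, Nat.cast_one, mul_one] at f3
  have hη : ((-1 : ℤ) ^ (j + 1)) * (-1) ^ (j + 1) = 1 := by
    rw [← mul_pow]; norm_num
  refine ⟨?_, ?_, ?_⟩
  · rw [pow_succ]; linear_combination -f3
  · rw [f1]; linear_combination (Nat.fib t : ℤ) * hη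
  · rw [pow_succ] at hη ⊢
    rw [f2]; linear_combination -(Nat.fib (t + 1) : ℤ) * hη

/-- The convergents alternate sides: the sign (-1)^(j+1) decides whether F_{j+2} is a record for the
numerator or for its complement. -/
theorem isRecord_fib (j t : ℕ) :
    ∃ m, IsRecord (Nat.fib (j + t + 1)) (Nat.fib (j + t + 2)) (Nat.fib (j + 2)) m ∨
      IsRecord (Nat.fib (j + t)) (Nat.fib (j + t + 2)) (Nat.fib (j + 2)) m := by
  obtain ⟨hdet, hD, hD'⟩ := fib_basis j t
  have key := fun s M => lt_of_lt_basis (s := s) (M := M) (neg_one_pow_eq_or ℤ _) hdet hD hD'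
    (by simp) (by simp) (by simp) (by simp)
  have ha : (Nat.fib (j + t + 2) : ℤ) = Nat.fib (j + t) + Nat.fib (j + t + 1) := by
    exact_mod_cast Nat.fib_add_two
  have hP : (Nat.fib (j + 2) : ℤ) = Nat.fib j + Nat.fib (j + 1) := by
    exact_mod_cast Nat.fib_add_two
  have ht : (0 : ℤ) ≤ Nat.fib t := by positivity
  rcases neg_one_pow_eq_or ℤ (j + 1) with hη | hη <;> rw [hη] at key hD
  · refine ⟨Nat.fib (j + 1), Or.inl ⟨?_, fun s m hs hsn hm => ?_⟩⟩
    · zify; linarith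
    · zify at hs hsn hm ⊢
      have := key s m (by linarith) hsn (by linarith)
      linarith
  · refine ⟨Nat.fib j, Or.inr ⟨?_, fun s m hs hsn hm => ?_⟩⟩
    · zify
      rw [ha, hP] at hD ⊢
      linarith
    · zify at hs hsn hm ⊢
      rw [ha] at hm
      -- Since b = a - c, one has b s - a m = -(c s - a (s - m)); this passes to the other side.
      have := key s (s - m) (by linarith) hsn (by rw [ha]; linarith)
      rw [ha] at this hD ⊢
      rw [hP] at hD ⊢
      linarith

theorem IsRecord.exists_fib {ℓ n m : ℕ} (hn : 1 ≤ n)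
    (h : IsRecord (Nat.fib (ℓ + 1)) (Nat.fib (ℓ + 2)) n m ∨
      IsRecord (Nat.fib ℓ) (Nat.fib (ℓ + 2)) n m) : ∃ j ≤ ℓ, Nat.fib (j + 2) = n := by
  have hle : n ≤ Nat.fib (ℓ + 2) := by
    rcases h with h | h <;> exact h.le (by simp)
  rcases hle.eq_or_lt with rfl | hlt
  · exact ⟨ℓ, le_rfl, rfl⟩
  obtain ⟨j, hj, hjn, hnj⟩ := exists_fib_le_lt hn ℓ hlt
  rcases hjn.eq_or_lt with rfl | hjn
  · exact ⟨j, hj.le, rfl⟩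
  exfalso
  obtain ⟨t, rfl⟩ := exists_add_of_le hj.le
  obtain ⟨hdet, hD, hD'⟩ := fib_basis j t
  have ht : 0 < t := by omega
  have hmono : Nat.fib j ≤ Nat.fib (j + 1) := Nat.fib_le_fib_succ
  have hmono' : Nat.fib (j + 1) ≤ Nat.fib (j + 2) := Nat.fib_le_fib_succ
  have hpos : 0 < Nat.fib (j + 1) := by simp
  have htpos : 0 < Nat.fib t := by simpa
  have htpos' : 0 < Nat.fib (t + 1) := by simp
  have key := fun M => le_or_le_of_between (n := n) (M := M) (neg_one_pow_eq_or ℤ _) hdet hD hD'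
    (by exact_mod_cast hpos) (by exact_mod_cast hmono') (by exact_mod_cast htpos)
    (by exact_mod_cast htpos') (by exact_mod_cast hjn)
    (by exact_mod_cast hnj.trans_eq (Nat.fib_add_two.trans (add_comm _ _)))
  have ha : Nat.fib (j + t + 2) = Nat.fib (j + t) + Nat.fib (j + t + 1) := Nat.fib_add_two
  -- A residue at n on the side of F_{j+2} is at least F_t, the residue there; on the other side it
  -- is at least F_{t+1}, the residue at F_{j+1}. Both indices are below n.
  rcases h with h | h
  · have h1 := h.1
    have h2 := h.2 (Nat.fib (j + 2)) (Nat.fib (j + 1)) (by omega) hjn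
    have h3 := h.2 (Nat.fib (j + 1)) (Nat.fib j) (by omega) (by omega)
    have hk := key m
    zify at h1 h2 h3 htpos htpos'
    rcases neg_one_pow_eq_or ℤ (j + 1) with hη | hη <;> rw [hη] at hk hD hD'
    · have := h2 (by linarith)
      rcases hk with hk | hk <;> linarith
    · have := h3 (by linarith)
      rcases hk with hk | hk <;> linarith
  · have h1 := h.1
    have h2 := h.2 (Nat.fib (j + 2)) (Nat.fib (j + 2) - Nat.fib (j + 1)) (by omega) hjn
    have h3 := h.2 (Nat.fib (j + 1)) (Nat.fib (j + 1) - Nat.fib j) (by omega) (by omega)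
    have hk := key (n - m)
    zify [hmono, hmono'] at h1 h2 h3 htpos htpos' ha
    rw [ha] at h1 h2 h3 hk hD hD'
    rcases neg_one_pow_eq_or ℤ (j + 1) with hη | hη <;> rw [hη] at hk hD hD'
    · have := h3 (by linarith)
      rcases hk with hk | hk <;> linarith
    · have := h2 (by linarith)
      rcases hk with hk | hk <;> linarith

end Fibonacci

/-! ### Sifted degrees, sifted type and relation type of the Fibonacci ideals -/

section FibIdeal

variable (k : Type*) [Field k]

theorem nontrivial_effectiveRelations_fibIdeal_iff (ℓ : ℕ) {n : ℕ} (hn : 2 ≤ n) :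
    Nontrivial (EffectiveRelations (fibIdeal k ℓ) n) ↔ n ∈ Nat.fib '' Set.Icc 2 (ℓ + 2) := by
  have ha : 0 < Nat.fib ℓ + Nat.fib (ℓ + 1) := by rw [← Nat.fib_add_two]; simp
  rw [fibIdeal_eq, nontrivial_effectiveRelations_threeIdeal_iff k ha hn, ← Nat.fib_add_two]
  constructor
  · rintro ⟨m, h⟩
    obtain ⟨j, hj, rfl⟩ := IsRecord.exists_fib (by omega) h
    exact ⟨j + 2, ⟨by omega, by omega⟩, rfl⟩
  · rintro ⟨i, ⟨h2, hi⟩, rfl⟩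
    obtain ⟨j, rfl⟩ := Nat.exists_eq_add_of_le' h2
    obtain ⟨t, rfl⟩ := exists_add_of_le (Nat.le_of_add_le_add_right hi)
    exact isRecord_fib j t

theorem siftedDegrees_fibIdeal (ℓ : ℕ) :
    siftedDegrees (fibIdeal k ℓ) = Nat.fib '' Set.Icc 2 (ℓ + 2) := by
  ext n
  rw [siftedDegrees, Set.mem_union, Set.mem_singleton_iff, Set.mem_ofPred_eq]
  constructor
  · rintro (rfl | ⟨hn, h⟩)
    · exact ⟨2, ⟨le_rfl, by omega⟩, rfl⟩
    · exact (nontrivial_effectiveRelations_fibIdeal_iff k ℓ hn).1 h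
  · intro h
    by_cases hn : 2 ≤ n
    · exact Or.inr ⟨hn, (nontrivial_effectiveRelations_fibIdeal_iff k ℓ hn).2 h⟩
    · obtain ⟨i, ⟨hi, -⟩, rfl⟩ := h
      have : 0 < Nat.fib i := by simp; omega
      left; omega

theorem siftedType_fibIdeal (ℓ : ℕ) : siftedType (fibIdeal k ℓ) = ℓ + 1 := by
  -- Indices start at 2, where the Fibonacci sequence becomes injective (F₁ = F₂).
  rw [siftedType, siftedDegrees_fibIdeal, Set.InjOn.ncard_image
    (Nat.fib_strictMonoOn.injOn.mono fun i hi => hi.1), Set.ncard_eq_toFinset_card']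
  simp

theorem relationType_fibIdeal (ℓ : ℕ) : relationType (fibIdeal k ℓ) = Nat.fib (ℓ + 2) := by
  have key : ∀ n, 2 ≤ n → (Subsingleton (EffectiveRelations (fibIdeal k ℓ) n) ↔
      n ∉ Nat.fib '' Set.Icc 2 (ℓ + 2)) := fun n hn => by
    rw [← nontrivial_effectiveRelations_fibIdeal_iff k ℓ hn, not_nontrivial_iff_subsingleton]
  have hpos : 0 < Nat.fib (ℓ + 2) := by simp
  refine IsLeast.csInf_eq ⟨⟨hpos, fun n hn => (key n (by omega)).2 ?_⟩, ?_⟩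
  · rintro ⟨i, ⟨-, hi⟩, rfl⟩
    have := Nat.fib_mono hi
    omega
  · rintro r ⟨hr, h⟩
    by_contra hlt
    exact (key _ (by omega)).1 (h (Nat.fib (ℓ + 2)) (by omega)) ⟨ℓ + 2, ⟨by omega, le_rfl⟩, rfl⟩

end FibIdeal

end

end Rees

theorem mainTheorem7 (k : Type*) [Field k] :
    (∀ ℓ : ℕ, 4 ≤ ℓ →
      Rees.siftedDegrees (Rees.fibIdeal k ℓ) = Nat.fib '' Set.Icc 2 (ℓ + 2) ∧
      Rees.siftedType (Rees.fibIdeal k ℓ) = ℓ + 1 ∧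
      Rees.relationType (Rees.fibIdeal k ℓ) = Nat.fib (ℓ + 2) ∧
      Rees.relationType (Rees.fibIdeal k ℓ) =
        Nat.fib (Rees.siftedType (Rees.fibIdeal k ℓ) + 1) ∧
      (Rees.relationType (Rees.fibIdeal k ℓ) : ℝ) =
        (Real.goldenRatio ^ (Rees.siftedType (Rees.fibIdeal k ℓ) + 1) -
          (-Real.goldenRatio⁻¹) ^ (Rees.siftedType (Rees.fibIdeal k ℓ) + 1)) / Real.sqrt 5) ∧
    (∀ m : ℕ, 1 ≤ m →
      ∃ I : Ideal (MvPolynomial (Fin 2) k), Rees.siftedType I = m) := by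
  refine ⟨fun ℓ _ => ?_, fun m hm => ⟨Rees.fibIdeal k (m - 1), ?_⟩⟩
  · rw [Rees.siftedType_fibIdeal, Rees.relationType_fibIdeal]
    refine ⟨Rees.siftedDegrees_fibIdeal k ℓ, rfl, rfl, rfl, ?_⟩
    -- -φ⁻¹ is the conjugate root, so this is Binet's formula.
    rw [Real.inv_goldenRatio, neg_neg, Real.coe_fib_eq]
  · rw [Rees.siftedType_fibIdeal]; omega
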